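/- A \emph{metrized graph} $\Gamma$ is a finite, non-empty, connected graph, self-loops and multiple edges allowed, with vertex set $V$ and edge set $E$, in which every edge $e$ is identified with a segment of length $L_e>0$ (with its end points glued to vertices). Write $\ell(\Gamma)=\sum_{e\in E}L_e$, let $v(p)$ be the number of directions emanating from $p\in\Gamma$, and for $x,y\in\Gamma$ let $r(x,y)$ be the effective resistance between $x$ and $y$ when $\Gamma$ is viewed as an electric circuit in which each edge has resistance equal to its length. For $e\in E$, let $R_e\in[0,\infty]$ be the effective resistance between the end points of $e$ in the graph obtained from $\Gamma$ by deleting the interior of $e$ ($R_e=\infty$ if this disconnects the end points, in which case $\frac{1}{L_e+R_e}=0$). Let $q:V\to\mathbb{Z}_{\ge 0}$ be such that the canonical divisor $K=\sum_{p\in V}(v(p)-2+2q(p))\,p$ is effective; the pair $(\Gamma,q)$ is then called a \emph{polarized metrized graph} (pm-graph). Its genus is $\bar g=|E|-|V|+1+\sum_{p\in V}q(p)$. Put $$\delta_K=\sum_{p\in V}(v(p)-2+2q(p))\,\delta_p,\qquad \mu_{ad}=\frac1{\bar g}\Big(\sum_{p\in V}q(p)\,\delta_p+\sum_{e\in E}\frac{dx|_e}{L_e+R_e}\Big),$$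 where $\delta_p$ is the Dirac measure at $p$ and $dx|_e$ is Lebesgue measure on $e$, and define $$\epsilon(\Gamma)=\iint_{\Gamma\times\Gamma}r(x,y)\,\delta_K(x)\,\mu_{ad}(y),\qquad Z(\Gamma)=\frac12\iint_{\Gamma\times\Gamma}r(x,y)\,\mu_{ad}(x)\,\mu_{ad}(y),$$ $$\varphi(\Gamma)=3\bar g\,Z(\Gamma)-\frac14\big(\epsilon(\Gamma)+\ell(\Gamma)\big),\qquad \lambda(\Gamma)=\frac{\bar g-1}{6(2\bar g+1)}\,\varphi(\Gamma)+\frac1{12}\big(\epsilon(\Gamma)+\ell(\Gamma)\big).$$ \textbf{Proposition.} Let $(\Gamma,q)$ be a pm-graph with exactly one vertex and with $|E|\ge 1$ edges, all of them self-loops at that vertex. Then $$\varphi(\Gamma)=\frac{\bar g-1}{6\bar g}\,\ell(\Gamma),\qquad Z(\Gamma)=\frac{2\bar g-1}{12\bar g^{2}}\,\ell(\Gamma),\qquad \lambda(\Gamma)=\frac{\bar g}{8\bar g+4}\,\ell(\Gamma),\qquad \epsilon(\Gamma)=\frac{\bar g-1}{3\bar g}\,\ell(\Gamma).$$ -/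

import Mathlib

/-- A finite multigraph (self-loops and multiple edges allowed), not necessarily connected, in which
every edge `e` is parametrized by the segment `[0, length e]`, starting at the vertex `src e` and
ending at the vertex `tgt e`. -/
structure LengthGraph (V E : Type*) where
  src : E → V
  tgt : E → V
  length : E → ℝ
  length_pos : ∀ e, 0 < length e

namespace LengthGraph

variable {V E : Type*}

/-- The points of the geometric realization: the vertices, and the interior points of the edges. -/
inductive Point (G : LengthGraph V E) where
  | vertex (v : V) : Point G
  | interior (e : E) (t : ℝ) (ht : t ∈ Set.Ioo 0 (G.length e)) : Point G

open Classical in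
/-- The parametrization of the edge `e` by `[0, length e]`, extended to `ℝ` by constants. -/
noncomputable def edgePath (G : LengthGraph V E) (e : E) (t : ℝ) : G.Point :=
  if ht : t ∈ Set.Ioo 0 (G.length e) then Point.interior e t ht
  else if t ≤ 0 then Point.vertex (G.src e) else Point.vertex (G.tgt e)

/-- An edge together with one of its two directions of travel; `true` is the given direction. -/
noncomputable def path (G : LengthGraph V E) (d : E × Bool) (t : ℝ) : G.Point :=
  if d.2 then G.edgePath d.1 t else G.edgePath d.1 (G.length d.1 - t)

/-- The directions emanating from the point `z`. -/
def directions (G : LengthGraph V E) (z : G.Point) : Set ((E × Bool) × ℝ) :=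
  {d | d.2 ∈ Set.Ico 0 (G.length d.1.1) ∧ G.path d.1 d.2 = z}

/-- The number of directions emanating from `z`. A self-loop at a vertex contributes two. -/
noncomputable def valence (G : LengthGraph V E) (z : G.Point) : ℕ :=
  (G.directions z).ncard

open Classical in
/-- `f` is a voltage function on `G`, viewed as an electric circuit whose edges have resistance
equal to their length, when unit current enters at `y` and exits at `x`: `f` is continuous and
piecewise affine (that is, affine near every point in each direction emanating from it, with
slope `σ`), the current in a direction is minus the slope (Ohm), and the total current that leaves
a point `z` through the edges is the current fed in at `z` (Kirchhoff). -/
def IsVoltage (G : LengthGraph V E) (x y : G.Point) (f : G.Point → ℝ) : Prop :=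
  ∃ σ : E × Bool → ℝ → ℝ,
    (∀ d : E × Bool, ∀ t ∈ Set.Ico 0 (G.length d.1),
      ∀ᶠ s in nhdsWithin t (Set.Ioi t), f (G.path d s) = f (G.path d t) + σ d t * (s - t)) ∧
    ∀ z : G.Point, -(∑ᶠ d ∈ G.directions z, σ d.1 d.2) =
      (if z = y then 1 else 0) - (if z = x then 1 else 0)

/-- The effective resistance between `x` and `y`: the voltage drop `f y - f x` when unit current
enters at `y` and exits at `x`. This number is the same for all such voltage functions `f`. If `x`
and `y` lie in different components, there is no such `f`, and the resistance is `∞`. -/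
noncomputable def resistance (G : LengthGraph V E) (x y : G.Point) : ENNReal :=
  ⨅ (f : G.Point → ℝ) (_ : G.IsVoltage x y f), ENNReal.ofReal (f y - f x)

/-- The graph with the interior of the edge `e` deleted. -/
def deleteEdge (G : LengthGraph V E) (e : E) : LengthGraph V {e' : E // e' ≠ e} where
  src e' := G.src e'
  tgt e' := G.tgt e'
  length e' := G.length e'
  length_pos e' := G.length_pos e'

/-- The resistance between the end points of `e` after the interior of `e` is deleted
(`∞` if `e` is a bridge). -/
noncomputable def deletedResistance (G : LengthGraph V E) (e : E) : ENNReal :=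
  (G.deleteEdge e).resistance (Point.vertex (G.src e)) (Point.vertex (G.tgt e))

/-- The quotient topology: the segments `[0, length e]` glued at their end points. -/
noncomputable instance (G : LengthGraph V E) : TopologicalSpace G.Point :=
  ⨆ e : E, TopologicalSpace.coinduced (G.edgePath e) inferInstance

noncomputable instance (G : LengthGraph V E) : MeasurableSpace G.Point := borel G.Point

instance (G : LengthGraph V E) : BorelSpace G.Point := ⟨rfl⟩

theorem continuous_edgePath (G : LengthGraph V E) (e : E) : Continuous (G.edgePath e) :=
  continuous_iSup_rng (i := e) continuous_coinduced_rng

/-- The Lebesgue measure `dx` on the edge `e`, as a measure on the graph. -/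
noncomputable def edgeMeasure (G : LengthGraph V E) (e : E) : MeasureTheory.Measure G.Point :=
  (MeasureTheory.volume.restrict (Set.Icc 0 (G.length e))).map (G.edgePath e)

/-- The sum of the lengths of the edges. -/
noncomputable def totalLength [Fintype E] (G : LengthGraph V E) : ℝ :=
  ∑ e, G.length e

/-- The first Betti number `e - v + 1` (of a connected graph). -/
def bettiNumber [Fintype V] [Fintype E] (_ : LengthGraph V E) : ℤ :=
  (Fintype.card E : ℤ) - Fintype.card V + 1

end LengthGraph

/-- A metrized graph (with finite vertex and edge sets): non-empty and connected. -/
structure MetrizedGraph (V E : Type*) [Fintype V] [Fintype E] extends LengthGraph V E where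
  nonempty : Nonempty V
  connected : ∀ u v : V, Relation.EqvGen (fun a b => ∃ e, src e = a ∧ tgt e = b) u v

/-- A polarized metrized graph: a metrized graph with a function `q ≥ 0` on the vertices for which
the canonical divisor `∑ (valence p - 2 + 2 q p) p` is effective. -/
structure PMGraph (V E : Type*) [Fintype V] [Fintype E] extends MetrizedGraph V E where
  q : V → ℕ
  effective : ∀ p : V,
    0 ≤ (toLengthGraph.valence (LengthGraph.Point.vertex p) : ℤ) - 2 + 2 * (q p : ℤ)

namespace PMGraph

variable {V E : Type*} [Fintype V] [Fintype E]

/-- The coefficient of the canonical divisor `K` at `p`. -/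
noncomputable def canonicalDivisor (G : PMGraph V E) (p : V) : ℤ :=
  (G.valence (LengthGraph.Point.vertex p) : ℤ) - 2 + 2 * (G.q p : ℤ)

/-- The measure `δ_K`. The coefficients of `K` are non-negative, so `toNat` loses nothing. -/
noncomputable def canonicalDivisorMeasure (G : PMGraph V E) : MeasureTheory.Measure G.Point :=
  ∑ p : V, (G.canonicalDivisor p).toNat •
    MeasureTheory.Measure.dirac (LengthGraph.Point.vertex p : G.Point)

/-- The genus of the polarized metrized graph. -/
def genus (G : PMGraph V E) : ℤ :=
  G.bettiNumber + ∑ p : V, (G.q p : ℤ)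

/-- The admissible measure `(1 / genus) (∑_p q(p) δ_p + ∑_e dx / (L_e + R_e))`. -/
noncomputable def admissibleMeasure (G : PMGraph V E) : MeasureTheory.Measure G.Point :=
  ENNReal.ofReal (1 / (G.genus : ℝ)) •
    (∑ p : V, G.q p • MeasureTheory.Measure.dirac (LengthGraph.Point.vertex p : G.Point) +
      ∑ e : E, (ENNReal.ofReal (G.length e) + G.deletedResistance e)⁻¹ • G.edgeMeasure e)

/-- The resistance function (finite on a connected graph) as a real-valued function. -/
noncomputable def r (G : PMGraph V E) (x y : G.Point) : ℝ :=
  (G.resistance x y).toReal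

/-- The invariant `ε`. -/
noncomputable def epsilonInv (G : PMGraph V E) : ℝ :=
  ∫ z : G.Point × G.Point, G.r z.1 z.2 ∂(G.canonicalDivisorMeasure.prod G.admissibleMeasure)

/-- The invariant `Z`. -/
noncomputable def zInv (G : PMGraph V E) : ℝ :=
  (1 / 2) * ∫ z : G.Point × G.Point, G.r z.1 z.2 ∂(G.admissibleMeasure.prod G.admissibleMeasure)

/-- The invariant `φ`. -/
noncomputable def phiInv (G : PMGraph V E) : ℝ :=
  3 * (G.genus : ℝ) * G.zInv - (1 / 4) * (G.epsilonInv + G.totalLength)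

/-- The invariant `λ`. -/
noncomputable def lambdaInv (G : PMGraph V E) : ℝ :=
  ((G.genus : ℝ) - 1) / (6 * (2 * (G.genus : ℝ) + 1)) * G.phiInv +
    (1 / 12) * (G.epsilonInv + G.totalLength)

end PMGraph

/-! A graph with one vertex is a bouquet of circles. Resistance is additive over the loops: r(x, y)
is the sum over e of the resistance on the circle e between the images of x and y when all other
loops are collapsed to the vertex (`LengthGraph.resistance_toReal_of_subsingleton`). As resistance
is defined by an infimum over voltage functions, this takes an explicit voltage
(`LengthGraph.isVoltage_loopVoltage`) and uniqueness of the voltage drop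
(`LengthGraph.IsVoltage.sub_eq_sub`).

The end points of a loop coincide, so R_e = 0; the measure g μ_ad gives every loop mass 1 and the
vertex mass q, and δ_K has mass 2g - 2 at the vertex. On a circle of length L the mean resistance
from any point is L/6 (`intervalIntegral_circleResistance`), and the remaining mass g - 1 of g μ_ad
sits at the vertex as seen from the loop e. Hence integrating the e-th summand against μ_ad gives
((g - 1) r_e(x, 0) + L_e/6)/g (`PMGraph.integral_circleResistance_coord`). Evaluating at the vertex
gives ε, integrating once more gives Z, and φ and λ follow by algebra. -/

open Set Filter MeasureTheory
open scoped Topology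

/-! ### Resistance on a circle and its mean value -/

/-- The effective resistance between the points at positions `s` and `t` of a circle of
circumference `L`. -/
noncomputable def circleResistance (L s t : ℝ) : ℝ :=
  |s - t| - (s - t) ^ 2 / L

theorem circleResistance_self (L s : ℝ) : circleResistance L s s = 0 := by
  simp [circleResistance]

theorem circleResistance_comm (L s t : ℝ) : circleResistance L s t = circleResistance L t s := by
  simp only [circleResistance, abs_sub_comm s t]
  ring

theorem circleResistance_reflect (L s t : ℝ) :
    circleResistance L (L - s) t = circleResistance L s (L - t) := by
  have h : L - s - t = -(s - (L - t)) := by ring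
  simp only [circleResistance, h, abs_neg, neg_sq]

/-- Positions 0 and L are the same point of the circle. -/
theorem circleResistance_length_left {L t : ℝ} (hL : 0 < L) (ht : t ∈ Icc 0 L) :
    circleResistance L L t = circleResistance L 0 t := by
  have h1 : |L - t| = L - t := abs_of_nonneg (by linarith [ht.2])
  have h2 : |0 - t| = t := by rw [zero_sub, abs_neg, abs_of_nonneg ht.1]
  simp only [circleResistance, h1, h2]
  field_simp
  ring

/-- With d = |s - t|, the value is d (L - d) / L: the arcs d and L - d in parallel. -/
theorem circleResistance_nonneg {L s t : ℝ} (hL : 0 < L) (hs : s ∈ Icc 0 L) (ht : t ∈ Icc 0 L) :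
    0 ≤ circleResistance L s t := by
  have h : |s - t| ≤ L := abs_le.2 ⟨by linarith [hs.1, ht.2], by linarith [hs.2, ht.1]⟩
  rw [circleResistance, sub_nonneg, div_le_iff₀ hL, ← sq_abs, sq]
  exact mul_le_mul_of_nonneg_left h (abs_nonneg _)

theorem circleResistance_le {L s t : ℝ} (hL : 0 < L) (hs : s ∈ Icc 0 L) (ht : t ∈ Icc 0 L) :
    circleResistance L s t ≤ L := by
  have h : |s - t| ≤ L := abs_le.2 ⟨by linarith [hs.1, ht.2], by linarith [hs.2, ht.1]⟩
  have h2 : 0 ≤ (s - t) ^ 2 / L := by positivity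
  rw [circleResistance]
  linarith

theorem continuous_circleResistance (L : ℝ) :
    Continuous fun p : ℝ × ℝ => circleResistance L p.1 p.2 := by
  unfold circleResistance
  fun_prop

theorem intervalIntegral_abs_sub {L s : ℝ} (hs : s ∈ Icc 0 L) :
    ∫ t in (0 : ℝ)..L, |s - t| = (s ^ 2 + (L - s) ^ 2) / 2 := by
  have hc : Continuous fun t : ℝ => |s - t| := by fun_prop
  have h1 : ∫ t in (0 : ℝ)..s, |s - t| = ∫ t in (0 : ℝ)..s, (s - t) := by
    refine intervalIntegral.integral_congr fun t ht => ?_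
    rw [uIcc_of_le hs.1] at ht
    exact abs_of_nonneg (by linarith [ht.2])
  have h2 : ∫ t in s..L, |s - t| = ∫ t in s..L, (t - s) := by
    refine intervalIntegral.integral_congr fun t ht => ?_
    rw [uIcc_of_le hs.2] at ht
    simp only [abs_sub_comm s t]
    exact abs_of_nonneg (by linarith [ht.1])
  rw [← intervalIntegral.integral_add_adjacent_intervals (hc.intervalIntegrable 0 s)
    (hc.intervalIntegrable s L), h1, h2,
    intervalIntegral.integral_sub (by simp) (by simp),
    intervalIntegral.integral_sub (by simp) (by simp)]
  simp only [intervalIntegral.integral_const, integral_id, smul_eq_mul]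
  ring

/-- The independence of s reflects the rotational symmetry of the circle. -/
theorem intervalIntegral_circleResistance {L s : ℝ} (hL : 0 < L) (hs : s ∈ Icc 0 L) :
    ∫ t in (0 : ℝ)..L, circleResistance L s t = L ^ 2 / 6 := by
  have hc : Continuous fun t : ℝ => |s - t| := by fun_prop
  have hd : Continuous fun t : ℝ => (s - t) ^ 2 / L := by fun_prop
  have h : ∫ t in (0 : ℝ)..L, (s - t) ^ 2 / L = (s ^ 3 + (L - s) ^ 3) / (3 * L) := by
    rw [intervalIntegral.integral_div,
      intervalIntegral.integral_comp_sub_left (fun t => t ^ 2) s, integral_pow]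
    field_simp
    norm_num
    ring
  simp only [circleResistance]
  rw [intervalIntegral.integral_sub (hc.intervalIntegrable _ _) (hd.intervalIntegrable _ _), h,
    intervalIntegral_abs_sub hs]
  field_simp
  ring

/-! ### Voltage on a circle -/

/-- The right derivative at `t` of `u ↦ |u - s|`. -/
noncomputable def absSubSlope (s t : ℝ) : ℝ :=
  if s ≤ t then 1 else -1

theorem eventually_abs_sub_eq (s t : ℝ) :
    ∀ᶠ u in 𝓝[>] t, |u - s| = |t - s| + absSubSlope s t * (u - t) := by
  by_cases h : s ≤ t
  · filter_upwards [self_mem_nhdsWithin] with u hu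
    have hu : t < u := hu
    rw [absSubSlope, if_pos h, abs_of_nonneg (by linarith), abs_of_nonneg (by linarith)]
    ring
  · have h' : t < s := not_le.1 h
    filter_upwards [nhdsWithin_le_nhds (Iio_mem_nhds h')] with u hu
    have hu : u < s := hu
    rw [absSubSlope, if_neg h, abs_of_neg (by linarith), abs_of_neg (by linarith)]
    ring

/-- The voltage on a circle of circumference `L` when unit current enters at position `b` and exits
at position `a`. -/
noncomputable def circleVoltage (L a b u : ℝ) : ℝ :=
  (circleResistance L u a - circleResistance L u b) / 2

/-- The right derivative of `circleVoltage`. -/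
noncomputable def circleVoltageSlope (L a b u : ℝ) : ℝ :=
  (absSubSlope a u - absSubSlope b u) / 2 + (a - b) / L

theorem circleVoltage_length {L a b : ℝ} (hL : 0 < L) (ha : a ∈ Icc 0 L) (hb : b ∈ Icc 0 L) :
    circleVoltage L a b L = circleVoltage L a b 0 := by
  simp only [circleVoltage, circleResistance_length_left hL ha, circleResistance_length_left hL hb]

theorem circleVoltage_reflect (L a b u : ℝ) :
    circleVoltage L a b (L - u) = circleVoltage L (L - a) (L - b) u := by
  simp only [circleVoltage, circleResistance_reflect]

/-- The terms quadratic in u cancel in the difference of the two resistances, which leaves an affine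
function with kinks only at a and b. -/
theorem eventually_circleVoltage_eq (L a b t : ℝ) :
    ∀ᶠ u in 𝓝[>] t,
      circleVoltage L a b u = circleVoltage L a b t + circleVoltageSlope L a b t * (u - t) := by
  filter_upwards [eventually_abs_sub_eq a t, eventually_abs_sub_eq b t] with u h1 h2
  simp only [circleVoltage, circleVoltageSlope, circleResistance, h1, h2]
  ring

/-- Away from the base point, the outgoing slopes in the two directions add up to the kink of the
voltage: the constant slope (a - b)/L cancels, and half the jump 2 of the slope of an absolute value
remains. -/
theorem circleVoltageSlope_add_reflect (L a b t : ℝ) :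
    circleVoltageSlope L a b t + circleVoltageSlope L (L - a) (L - b) (L - t) =
      (if a = t then 1 else 0) - (if b = t then 1 else 0) := by
  have key : ∀ s : ℝ, absSubSlope s t + absSubSlope (L - s) (L - t) =
      2 * (if s = t then 1 else 0) := by
    intro s
    simp only [absSubSlope, sub_le_sub_iff_left]
    rcases lt_trichotomy s t with h | h | h
    · simp [h.le, h.not_ge, h.ne]
    · subst h; norm_num
    · simp [h.le, h.not_ge, h.ne']
  have ha := key a
  have hb := key b
  simp only [circleVoltageSlope]
  linear_combination (ha - hb) / 2

theorem circleVoltageSlope_zero_add_reflect {L a b : ℝ} (ha : a ∈ Ico 0 L) (hb : b ∈ Ico 0 L) :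
    circleVoltageSlope L a b 0 + circleVoltageSlope L (L - a) (L - b) 0 =
      (if a = 0 then 1 else 0) - (if b = 0 then 1 else 0) := by
  -- The base point is left at 0 in both directions, so each absolute value contributes an extra -2;
  -- it is the same for a and b and drops out of their difference.
  have key : ∀ s ∈ Ico 0 L, absSubSlope s 0 + absSubSlope (L - s) 0 =
      2 * (if s = 0 then 1 else 0) - 2 := by
    intro s hs
    have h2 : ¬ (L - s ≤ 0) := by have := hs.2; linarith
    simp only [absSubSlope, if_neg h2]
    rcases hs.1.eq_or_lt with h | h
    · subst h; norm_num
    · simp only [if_neg h.not_ge, if_neg h.ne']; norm_num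
  have ha := key a ha
  have hb := key b hb
  simp only [circleVoltageSlope]
  linear_combination (ha - hb) / 2

/-! ### Rigidity of kink-free functions on a loop -/

/-- A function on `[0, L]` with equal values at the end points that is locally affine, without
kinks in the interior, is constant. -/
theorem eq_of_locally_affine {g a b : ℝ → ℝ} {L : ℝ} (hend : g 0 = g L)
    (hright : ∀ t ∈ Ico 0 L, ∀ᶠ s in 𝓝[>] t, g s = g t + a t * (s - t))
    (hleft : ∀ t ∈ Ico 0 L, ∀ᶠ s in 𝓝[>] t, g (L - s) = g (L - t) + b t * (s - t))
    (hab : ∀ t ∈ Ioo 0 L, a t + b (L - t) = 0) {t : ℝ} (ht : t ∈ Icc 0 L) : g t = g 0 := by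
  -- The reversed parametrization reaches the position t at parameter L - t, so its right-hand
  -- expansion there is a left-hand expansion of g at t.
  have hleft' : ∀ t ∈ Ioc 0 L, ∀ᶠ s in 𝓝[<] t, g s = g t + b (L - t) * (t - s) := by
    intro t ht
    have h := hleft (L - t) ⟨by linarith [ht.2], by linarith [ht.1]⟩
    have hm : Tendsto (fun s => L - s) (𝓝[<] t) (𝓝[>] (L - t)) := by
      refine tendsto_nhdsWithin_iff.2 ⟨?_, ?_⟩
      · exact ((continuous_const.sub continuous_id).tendsto t).mono_left nhdsWithin_le_nhds
      · filter_upwards [self_mem_nhdsWithin] with s hs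
        have hs : s < t := hs
        exact sub_lt_sub_left hs L
    filter_upwards [hm.eventually h] with s hs
    rw [sub_sub_cancel, sub_sub_cancel] at hs
    rw [hs]
    ring
  have hcr : ∀ t ∈ Ico 0 L, ContinuousWithinAt g (Ioi t) t := by
    intro t ht
    have hc : ContinuousWithinAt (fun s => g t + a t * (s - t)) (Ioi t) t :=
      Continuous.continuousWithinAt (by fun_prop)
    exact hc.congr_of_eventuallyEq (hright t ht) (by simp)
  have hcl : ∀ t ∈ Ioc 0 L, ContinuousWithinAt g (Iio t) t := by
    intro t ht
    have hc : ContinuousWithinAt (fun s => g t + b (L - t) * (t - s)) (Iio t) t :=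
      Continuous.continuousWithinAt (by fun_prop)
    exact hc.congr_of_eventuallyEq (hleft' t ht) (by simp)
  have hloc : ∀ t ∈ Ioo 0 L, ∀ᶠ s in 𝓝 t, g s = g t + a t * (s - t) := by
    intro t ht
    -- A neighbourhood splits into left side, right side and the point; `hab` makes the two
    -- one-sided slopes agree.
    rw [← nhdsLT_sup_nhdsGE, ← nhdsGT_sup_nhdsWithin_singleton, eventually_sup, eventually_sup]
    refine ⟨?_, hright t ⟨ht.1.le, ht.2⟩, by simp⟩
    filter_upwards [hleft' t ⟨ht.1, ht.2.le⟩] with s hs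
    rw [hs, eq_neg_of_add_eq_zero_left (hab t ht)]
    ring
  have hderiv : ∀ t ∈ Ioo 0 L, HasDerivAt g (a t) t := by
    intro t ht
    have hd : HasDerivAt (fun s => g t + a t * (s - t)) (a t) t := by
      simpa using (((hasDerivAt_id t).sub_const t).const_mul (a t)).const_add (g t)
    exact hd.congr_of_eventuallyEq (hloc t ht)
  have hderiv2 : ∀ t ∈ Ioo 0 L, HasDerivAt (deriv g) 0 t := by
    intro t ht
    have he : deriv g =ᶠ[𝓝 t] fun _ => a t := by
      filter_upwards [(hloc t ht).eventually_nhds] with s hs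
      have hd : HasDerivAt (fun u => g t + a t * (u - t)) (a t) s := by
        simpa using (((hasDerivAt_id s).sub_const t).const_mul (a t)).const_add (g t)
      exact (hd.congr_of_eventuallyEq hs).deriv
    exact (hasDerivAt_const t (a t)).congr_of_eventuallyEq he
  have hcont : ContinuousOn g (Icc 0 L) := by
    intro t ht
    rcases ht.1.eq_or_lt with h | h
    · subst h
      rcases ht.2.eq_or_lt with h' | h'
      · subst h'; simp
      · have := continuousWithinAt_insert_self.2 (hcr 0 ⟨le_rfl, h'⟩)
        rw [Ioi_insert] at this
        exact this.mono fun s hs => hs.1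
    · rcases ht.2.eq_or_lt with h' | h'
      · subst h'
        have := continuousWithinAt_insert_self.2 (hcl t ⟨h, le_rfl⟩)
        rw [Iio_insert] at this
        exact this.mono fun s hs => hs.2
      · exact (hderiv t ⟨h, h'⟩).continuousAt.continuousWithinAt
  rcases ht.1.eq_or_lt with h | h
  · rw [← h]
  -- Rolle gives a zero of g'; as g'' = 0, g' vanishes on the whole interior, and the mean value
  -- theorem on [0, t] concludes.
  obtain ⟨c, hc, hc0⟩ := exists_deriv_eq_zero (h.trans_le ht.2) hcont hend
  obtain ⟨c', hc', hslope⟩ := exists_deriv_eq_slope g h (hcont.mono (Icc_subset_Icc_right ht.2))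
    fun s hs => (hderiv s ⟨hs.1, hs.2.trans_le ht.2⟩).differentiableAt.differentiableWithinAt
  have hcc : deriv g c' = deriv g c :=
    isOpen_Ioo.is_const_of_deriv_eq_zero isPreconnected_Ioo
      (fun s hs => (hderiv2 s hs).differentiableAt.differentiableWithinAt)
      (fun s hs => (hderiv2 s hs).deriv) ⟨hc'.1, hc'.2.trans_le ht.2⟩ hc
  rw [hcc, hc0, eq_comm, div_eq_zero_iff] at hslope
  rcases hslope with h' | h' <;> linarith

/-! ### Directions, valence and deleted resistance on a one-vertex graph -/

namespace LengthGraph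

variable {V E : Type*}

theorem edgePath_of_mem (G : LengthGraph V E) {e : E} {t : ℝ} (ht : t ∈ Ioo 0 (G.length e)) :
    G.edgePath e t = Point.interior e t ht :=
  dif_pos ht

theorem edgePath_of_notMem [Subsingleton V] (G : LengthGraph V E) (v : V) {e : E} {t : ℝ}
    (ht : t ∉ Ioo 0 (G.length e)) : G.edgePath e t = Point.vertex v := by
  rw [edgePath, dif_neg ht]
  split_ifs <;> exact congrArg _ (Subsingleton.elim _ _)

theorem path_true (G : LengthGraph V E) (e : E) (t : ℝ) : G.path (e, true) t = G.edgePath e t :=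
  rfl

theorem path_false (G : LengthGraph V E) (e : E) (t : ℝ) :
    G.path (e, false) t = G.edgePath e (G.length e - t) :=
  rfl

theorem directions_vertex [Subsingleton V] (G : LengthGraph V E) (v : V) :
    G.directions (Point.vertex v) = range fun d : E × Bool => (d, (0 : ℝ)) := by
  ext ⟨⟨e, b⟩, t⟩
  have hL := G.length_pos e
  simp only [directions, mem_ofPred_eq, mem_range, Prod.mk.injEq]
  constructor
  · rintro ⟨ht, hp⟩
    refine ⟨(e, b), rfl, ?_⟩
    by_contra h0
    have ht0 : 0 < t := lt_of_le_of_ne ht.1 h0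
    cases b
    · rw [path_false, edgePath_of_mem G ⟨sub_pos.2 ht.2, sub_lt_self _ ht0⟩] at hp
      cases hp
    · rw [path_true, edgePath_of_mem G ⟨ht0, ht.2⟩] at hp
      cases hp
  · rintro ⟨d, rfl, rfl⟩
    refine ⟨⟨le_rfl, hL⟩, ?_⟩
    cases b
    · rw [path_false, edgePath_of_notMem G v (by simp)]
    · rw [path_true, edgePath_of_notMem G v (by simp)]

theorem directions_interior (G : LengthGraph V E) {e : E} {t : ℝ}
    (ht : t ∈ Ioo 0 (G.length e)) :
    G.directions (Point.interior e t ht) = {((e, true), t), ((e, false), G.length e - t)} := by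
  ext ⟨⟨e', b⟩, u⟩
  simp only [directions, mem_ofPred_eq, mem_insert_iff, mem_singleton_iff, Prod.mk.injEq]
  constructor
  · rintro ⟨-, hp⟩
    cases b
    · rw [path_false, edgePath] at hp
      split_ifs at hp
      obtain ⟨rfl, h⟩ := Point.interior.inj hp
      exact Or.inr ⟨⟨rfl, rfl⟩, by linarith⟩
    · rw [path_true, edgePath] at hp
      split_ifs at hp
      obtain ⟨rfl, h⟩ := Point.interior.inj hp
      exact Or.inl ⟨⟨rfl, rfl⟩, h⟩
  · rintro (⟨⟨rfl, rfl⟩, rfl⟩ | ⟨⟨rfl, rfl⟩, rfl⟩)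
    · exact ⟨⟨ht.1.le, ht.2⟩, by rw [path_true, edgePath_of_mem G ht]⟩
    · refine ⟨⟨by linarith [ht.2], by linarith [ht.1]⟩, ?_⟩
      rw [path_false, sub_sub_cancel, edgePath_of_mem G ht]

theorem finsum_directions_vertex [Subsingleton V] [Fintype E] (G : LengthGraph V E) (v : V)
    (σ : E × Bool → ℝ → ℝ) :
    ∑ᶠ d ∈ G.directions (Point.vertex v), σ d.1 d.2 =
      ∑ e, (σ (e, true) 0 + σ (e, false) 0) := by
  rw [directions_vertex, finsum_mem_range fun _ _ h => (Prod.mk.inj h).1,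
    finsum_eq_sum_of_fintype, Fintype.sum_prod_type]
  simp

theorem finsum_directions_interior (G : LengthGraph V E) {e : E} {t : ℝ}
    (ht : t ∈ Ioo 0 (G.length e)) (σ : E × Bool → ℝ → ℝ) :
    ∑ᶠ d ∈ G.directions (Point.interior e t ht), σ d.1 d.2 =
      σ (e, true) t + σ (e, false) (G.length e - t) := by
  rw [directions_interior, finsum_mem_pair (by simp)]

theorem valence_vertex [Subsingleton V] [Fintype E] (G : LengthGraph V E) (v : V) :
    G.valence (Point.vertex v) = 2 * Fintype.card E := by
  rw [valence, directions_vertex, ← image_univ,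
    ncard_image_of_injective _ fun _ _ h => (Prod.mk.inj h).1, ncard_univ, Nat.card_eq_fintype_card,
    Fintype.card_prod, Fintype.card_bool, mul_comm]

theorem resistance_self (G : LengthGraph V E) (x : G.Point) : G.resistance x x = 0 := by
  refine le_antisymm ((iInf₂_le (fun _ => 0) ⟨fun _ _ => 0, ?_, ?_⟩).trans (by simp)) zero_le
  · intro d t _
    simp
  · intro z
    simp

/-- The two end points of a loop are the same point, and the zero function is a voltage from a point
to itself. -/
theorem deletedResistance_of_subsingleton [Subsingleton V] (G : LengthGraph V E) (e : E) :
    G.deletedResistance e = 0 := by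
  rw [deletedResistance, Subsingleton.elim (G.tgt e) (G.src e), resistance_self]

/-! ### Collapsing all loops but one -/

open Classical in
/-- The position of a point on the edge `e`; zero for the points outside the interior of `e`. -/
noncomputable def coord (G : LengthGraph V E) (e : E) : G.Point → ℝ
  | Point.vertex _ => 0
  | Point.interior e' t _ => if e' = e then t else 0

theorem coord_vertex (G : LengthGraph V E) (e : E) (v : V) :
    G.coord e (Point.vertex v) = 0 :=
  rfl

theorem coord_interior_self (G : LengthGraph V E) {e : E} {t : ℝ}
    (ht : t ∈ Ioo 0 (G.length e)) : G.coord e (Point.interior e t ht) = t :=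
  if_pos rfl

theorem coord_interior_of_ne (G : LengthGraph V E) {e e' : E} (h : e' ≠ e) {t : ℝ}
    (ht : t ∈ Ioo 0 (G.length e')) : G.coord e (Point.interior e' t ht) = 0 :=
  if_neg h

theorem coord_mem (G : LengthGraph V E) (e : E) (x : G.Point) :
    G.coord e x ∈ Ico 0 (G.length e) := by
  have hL := G.length_pos e
  cases x with
  | vertex v => exact ⟨le_rfl, hL⟩
  | interior e' t ht =>
    by_cases h : e' = e
    · subst h
      rw [coord_interior_self]
      exact ⟨ht.1.le, ht.2⟩
    · rw [coord_interior_of_ne G h]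
      exact ⟨le_rfl, hL⟩

theorem coord_mem_Icc (G : LengthGraph V E) (e : E) (x : G.Point) :
    G.coord e x ∈ Icc 0 (G.length e) :=
  Ico_subset_Icc_self (G.coord_mem e x)

theorem coord_edgePath_self (G : LengthGraph V E) {e : E} {t : ℝ}
    (ht : t ∈ Ico 0 (G.length e)) : G.coord e (G.edgePath e t) = t := by
  rcases ht.1.eq_or_lt with h | h
  · subst h
    rw [edgePath, dif_neg (by simp), if_pos le_rfl, coord_vertex]
  · have ht' : t ∈ Ioo 0 (G.length e) := ⟨h, ht.2⟩
    rw [edgePath_of_mem G ht', coord_interior_self]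

theorem coord_edgePath_length (G : LengthGraph V E) (e : E) :
    G.coord e (G.edgePath e (G.length e)) = 0 := by
  rw [edgePath, dif_neg (by simp), if_neg (G.length_pos e).not_ge, coord_vertex]

theorem coord_edgePath_of_ne (G : LengthGraph V E) {e e' : E} (h : e' ≠ e) (t : ℝ) :
    G.coord e (G.edgePath e' t) = 0 := by
  rw [edgePath]
  split_ifs
  · exact coord_interior_of_ne G h _
  · rfl
  · rfl

theorem coord_eq_iff (G : LengthGraph V E) {e : E} {t : ℝ} (ht : t ∈ Ioo 0 (G.length e))
    (x : G.Point) : G.coord e x = t ↔ Point.interior e t ht = x := by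
  refine ⟨fun h => ?_, fun h => by rw [← h, coord_interior_self]⟩
  cases x with
  | vertex v => exact absurd h ht.1.ne
  | interior e' u hu =>
    by_cases he : e' = e
    · subst he
      rw [coord_interior_self] at h
      subst h
      rfl
    · rw [coord_interior_of_ne G he] at h
      exact absurd h ht.1.ne

open Classical in
-- The vertex has coordinate 0 on every loop, an interior point on all loops but its own. The excess
-- |E| - 1 does not depend on x, so it cancels between source and sink in Kirchhoff's law at the
-- vertex.
theorem sum_coord_eq_zero [Subsingleton V] [Fintype E] (G : LengthGraph V E) (v : V)
    (x : G.Point) :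
    ∑ e, (if G.coord e x = 0 then (1 : ℝ) else 0) =
      Fintype.card E - 1 + if Point.vertex v = x then 1 else 0 := by
  cases x with
  | vertex w =>
    rw [Subsingleton.elim w v]
    simp [coord_vertex]
  | interior e' t ht =>
    have h : ∀ e, (if G.coord e (Point.interior e' t ht) = 0 then (1 : ℝ) else 0) =
        1 - if e = e' then 1 else 0 := by
      intro e
      by_cases he : e = e'
      · subst he
        rw [coord_interior_self, if_neg ht.1.ne', if_pos rfl, sub_self]
      · rw [coord_interior_of_ne G (Ne.symm he), if_pos rfl, if_neg he, sub_zero]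
    simp [h]

/-! ### Existence and uniqueness of voltages; the resistance formula -/

/-- On a graph with one vertex, the voltage when unit current enters at `y` and exits at `x`. -/
noncomputable def loopVoltage [Fintype E] (G : LengthGraph V E) (x y z : G.Point) : ℝ :=
  ∑ e, circleVoltage (G.length e) (G.coord e x) (G.coord e y) (G.coord e z)

/-- Along e only the e-th summand varies. At the far end the coordinate falls back to 0, which is
harmless because the circle voltage agrees at 0 and at the full length. -/
theorem loopVoltage_edgePath [Fintype E] (G : LengthGraph V E) (x y : G.Point) (e : E) :
    ∃ C, ∀ t ∈ Icc 0 (G.length e), G.loopVoltage x y (G.edgePath e t) =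
      C + circleVoltage (G.length e) (G.coord e x) (G.coord e y) t := by
  classical
  refine ⟨∑ e' ∈ Finset.univ.erase e,
    circleVoltage (G.length e') (G.coord e' x) (G.coord e' y) 0, fun t ht => ?_⟩
  rw [loopVoltage, ← Finset.sum_erase_add _ _ (Finset.mem_univ e)]
  congr 1
  · refine Finset.sum_congr rfl fun e' he' => ?_
    rw [coord_edgePath_of_ne G (Finset.ne_of_mem_erase he').symm]
  · rcases ht.2.eq_or_lt with h | h
    · rw [h, coord_edgePath_length,
        circleVoltage_length (G.length_pos e) (G.coord_mem_Icc e x) (G.coord_mem_Icc e y)]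
    · rw [coord_edgePath_self G ⟨ht.1, h⟩]

/-- The slopes of `loopVoltage`. -/
noncomputable def loopVoltageSlope (G : LengthGraph V E) (x y : G.Point) (d : E × Bool) (t : ℝ) :
    ℝ :=
  if d.2 then circleVoltageSlope (G.length d.1) (G.coord d.1 x) (G.coord d.1 y) t
  else circleVoltageSlope (G.length d.1) (G.length d.1 - G.coord d.1 x)
    (G.length d.1 - G.coord d.1 y) t

theorem isVoltage_loopVoltage [Subsingleton V] [Fintype E] (G : LengthGraph V E)
    (x y : G.Point) : G.IsVoltage x y (G.loopVoltage x y) := by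
  classical
  refine ⟨G.loopVoltageSlope x y, ?_, ?_⟩
  · rintro ⟨e, b⟩ t ht
    obtain ⟨C, hC⟩ := G.loopVoltage_edgePath x y e
    have hmem : ∀ᶠ s in 𝓝[>] t, s ∈ Ioo t (G.length e) := Ioo_mem_nhdsGT ht.2
    have ht : t ∈ Ico 0 (G.length e) := ht
    cases b
    · filter_upwards [hmem, eventually_circleVoltage_eq (G.length e)
        (G.length e - G.coord e x) (G.length e - G.coord e y) t] with s hs h
      rw [path_false, path_false, hC _ ⟨by linarith [hs.2], by linarith [hs.1, ht.1]⟩,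
        hC _ ⟨by linarith [ht.2], by linarith [ht.1]⟩, circleVoltage_reflect,
        circleVoltage_reflect, h, loopVoltageSlope, if_neg (by simp)]
      ring
    · filter_upwards [hmem, eventually_circleVoltage_eq (G.length e)
        (G.coord e x) (G.coord e y) t] with s hs h
      rw [path_true, path_true, hC _ ⟨by linarith [hs.1, ht.1], hs.2.le⟩, hC _ ⟨ht.1, ht.2.le⟩, h,
        loopVoltageSlope, if_pos rfl]
      ring
  · intro z
    cases z with
    | vertex v =>
      rw [finsum_directions_vertex]
      have h : ∀ e, G.loopVoltageSlope x y (e, true) 0 + G.loopVoltageSlope x y (e, false) 0 =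
          (if G.coord e x = 0 then 1 else 0) - (if G.coord e y = 0 then 1 else 0) :=
        fun e => circleVoltageSlope_zero_add_reflect (G.coord_mem e x) (G.coord_mem e y)
      simp only [h, Finset.sum_sub_distrib, sum_coord_eq_zero G v]
      ring
    | interior e t ht =>
      have h : G.loopVoltageSlope x y (e, true) t +
          G.loopVoltageSlope x y (e, false) (G.length e - t) =
          (if G.coord e x = t then 1 else 0) - (if G.coord e y = t then 1 else 0) :=
        circleVoltageSlope_add_reflect _ _ _ _
      rw [finsum_directions_interior, h]
      simp only [coord_eq_iff G ht]
      ring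

/-- On a graph with one vertex, two voltage functions differ by a constant. -/
theorem IsVoltage.sub_eq_sub [Subsingleton V] {G : LengthGraph V E} {x y : G.Point}
    {f g : G.Point → ℝ} (hf : G.IsVoltage x y f) (hg : G.IsVoltage x y g) :
    f y - f x = g y - g x := by
  obtain ⟨σ, hσ, hσ'⟩ := hf
  obtain ⟨τ, hτ, hτ'⟩ := hg
  have key : ∀ (v : V) (z : G.Point), f z - g z = f (Point.vertex v) - g (Point.vertex v) := by
    intro v z
    cases z with
    | vertex w => rw [Subsingleton.elim w v]
    | interior e t ht =>
      have h0 : G.edgePath e 0 = Point.vertex v := edgePath_of_notMem G v (by simp)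
      have hL : G.edgePath e (G.length e) = Point.vertex v := edgePath_of_notMem G v (by simp)
      -- Both functions obey Kirchhoff's law with the same currents, so their difference has no kink
      -- inside e; its values at the two ends agree because e is a loop.
      have h := eq_of_locally_affine (g := fun s => f (G.edgePath e s) - g (G.edgePath e s))
        (a := fun s => σ (e, true) s - τ (e, true) s)
        (b := fun s => σ (e, false) s - τ (e, false) s) (L := G.length e) (t := t)
        (by simp only [h0, hL]) ?_ ?_ ?_ ⟨ht.1.le, ht.2.le⟩
      · simpa only [h0, edgePath_of_mem G ht] using h
      · intro t ht
        filter_upwards [hσ (e, true) t ht, hτ (e, true) t ht] with s h1 h2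
        simp only [path_true] at h1 h2
        rw [h1, h2]
        ring
      · intro t ht
        filter_upwards [hσ (e, false) t ht, hτ (e, false) t ht] with s h1 h2
        simp only [path_false] at h1 h2
        rw [h1, h2]
        ring
      · intro t ht
        have h1 := hσ' (Point.interior e t ht)
        have h2 := hτ' (Point.interior e t ht)
        rw [finsum_directions_interior] at h1 h2
        linarith
  have hv : ∃ v : V, True := by
    cases x with
    | vertex v => exact ⟨v, trivial⟩
    | interior e _ _ => exact ⟨G.src e, trivial⟩
  obtain ⟨v, -⟩ := hv
  linarith [key v x, key v y]

theorem loopVoltage_sub [Fintype E] (G : LengthGraph V E) (x y : G.Point) :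
    G.loopVoltage x y y - G.loopVoltage x y x =
      ∑ e, circleResistance (G.length e) (G.coord e x) (G.coord e y) := by
  rw [loopVoltage, loopVoltage, ← Finset.sum_sub_distrib]
  refine Finset.sum_congr rfl fun e _ => ?_
  rw [circleVoltage, circleVoltage, circleResistance_self, circleResistance_self,
    circleResistance_comm _ (G.coord e y)]
  ring

/-- The explicit voltage bounds the infimum from above, and by uniqueness every competitor has the
same drop. -/
theorem resistance_toReal_of_subsingleton [Subsingleton V] [Fintype E] (G : LengthGraph V E)
    (x y : G.Point) :
    (G.resistance x y).toReal =
      ∑ e, circleResistance (G.length e) (G.coord e x) (G.coord e y) := by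
  have h : G.resistance x y =
      ENNReal.ofReal (∑ e, circleResistance (G.length e) (G.coord e x) (G.coord e y)) := by
    rw [← loopVoltage_sub]
    refine le_antisymm (iInf₂_le _ (G.isVoltage_loopVoltage x y)) (le_iInf₂ fun f hf => ?_)
    rw [hf.sub_eq_sub (G.isVoltage_loopVoltage x y)]
  rw [h, ENNReal.toReal_ofReal (Finset.sum_nonneg fun e _ => circleResistance_nonneg
    (G.length_pos e) (G.coord_mem_Icc e x) (G.coord_mem_Icc e y))]

/-! ### Topology, measurability of the coordinates, integration along an edge -/

theorem isOpen_iff (G : LengthGraph V E) {U : Set G.Point} :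
    IsOpen U ↔ ∀ e, IsOpen (G.edgePath e ⁻¹' U) := by
  refine isOpen_iSup_iff.trans (forall_congr' fun e => ?_)
  exact isOpen_coinduced

/-- Interiors of distinct edges are disjoint and each is parametrized injectively, so the image
pulls back to W along e and to the empty set along every other edge. -/
theorem isOpen_edgePath_image (G : LengthGraph V E) (e : E) {W : Set ℝ} (hW : IsOpen W)
    (h : W ⊆ Ioo 0 (G.length e)) : IsOpen (G.edgePath e '' W) := by
  have hiff : ∀ e' t, G.edgePath e' t ∈ G.edgePath e '' W ↔ e' = e ∧ t ∈ W := by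
    refine fun e' t => ⟨?_, fun ⟨he, ht⟩ => he ▸ mem_image_of_mem _ ht⟩
    rintro ⟨s, hs, hst⟩
    rw [edgePath_of_mem G (h hs), edgePath] at hst
    split_ifs at hst
    obtain ⟨rfl, rfl⟩ := Point.interior.inj hst
    exact ⟨rfl, hs⟩
  rw [isOpen_iff]
  intro e'
  by_cases he : e' = e
  · have : G.edgePath e' ⁻¹' (G.edgePath e '' W) = W := by
      ext t
      simp [hiff, he]
    rwa [this]
  · have : G.edgePath e' ⁻¹' (G.edgePath e '' W) = ∅ := by
      ext t
      simp [hiff, he]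
    rw [this]
    exact isOpen_empty

theorem coord_preimage_eq (G : LengthGraph V E) (e : E) {W : Set ℝ} (hW : (0 : ℝ) ∉ W) :
    G.coord e ⁻¹' W = G.edgePath e '' (W ∩ Ioo 0 (G.length e)) := by
  ext x
  constructor
  · intro hx
    have hx : G.coord e x ∈ W := hx
    have hm := G.coord_mem e x
    have ht : G.coord e x ∈ Ioo 0 (G.length e) :=
      ⟨lt_of_le_of_ne hm.1 fun h => hW (h ▸ hx), hm.2⟩
    refine ⟨_, ⟨hx, ht⟩, ?_⟩
    rw [edgePath_of_mem G ht]
    exact (G.coord_eq_iff ht x).1 rfl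
  · rintro ⟨t, ⟨htW, ht⟩, rfl⟩
    rw [mem_preimage, coord_edgePath_self G ⟨ht.1.le, ht.2⟩]
    exact htW

/-- The coordinate is not continuous: it jumps from the length of e to 0 at the far end. Preimages
of open sets that avoid 0 are still open, and the fibre over 0 is the complement of such a preimage.
-/
theorem measurable_coord (G : LengthGraph V E) (e : E) : Measurable (G.coord e) := by
  have h0 : ∀ W : Set ℝ, IsOpen W → (0 : ℝ) ∉ W → MeasurableSet (G.coord e ⁻¹' W) := by
    intro W hW h
    rw [coord_preimage_eq G e h]
    exact (isOpen_edgePath_image G e (hW.inter isOpen_Ioo) inter_subset_right).measurableSet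
  refine measurable_of_isOpen fun W hW => ?_
  by_cases h : (0 : ℝ) ∈ W
  · have h1 := h0 (W \ {0}) (hW.sdiff isClosed_singleton) (by simp)
    have h2 := (h0 {0}ᶜ isOpen_compl_singleton (by simp)).compl
    convert h1.union h2 using 1
    ext x
    by_cases hx : G.coord e x = 0 <;> simp [hx, h]
  · exact h0 W hW h

theorem integral_edgeMeasure (G : LengthGraph V E) (e : E) {F : G.Point → ℝ} (hF : Measurable F) :
    ∫ x, F x ∂G.edgeMeasure e = ∫ t in (0 : ℝ)..G.length e, F (G.edgePath e t) := by
  rw [edgeMeasure, integral_map (G.continuous_edgePath e).measurable.aemeasurable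
    hF.aestronglyMeasurable, integral_Icc_eq_integral_Ioc,
    intervalIntegral.integral_of_le (G.length_pos e).le]

theorem isFiniteMeasure_edgeMeasure (G : LengthGraph V E) (e : E) :
    IsFiniteMeasure (G.edgeMeasure e) := by
  rw [edgeMeasure]
  infer_instance

end LengthGraph

/-! ### The canonical and admissible measures of a bouquet -/

namespace PMGraph

variable {V E : Type*} [Fintype V] [Fintype E]

theorem measurable_circleResistance_coord (G : PMGraph V E) (e : E) :
    Measurable fun z : G.Point × G.Point =>
      circleResistance (G.length e) (G.coord e z.1) (G.coord e z.2) :=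
  (continuous_circleResistance (G.length e)).measurable.comp
    (((G.measurable_coord e).comp measurable_fst).prodMk
      ((G.measurable_coord e).comp measurable_snd))

theorem norm_circleResistance_coord_le (G : PMGraph V E) (e : E) (x y : G.Point) :
    ‖circleResistance (G.length e) (G.coord e x) (G.coord e y)‖ ≤ G.length e := by
  rw [Real.norm_of_nonneg (circleResistance_nonneg (G.length_pos e) (G.coord_mem_Icc e x)
    (G.coord_mem_Icc e y))]
  exact circleResistance_le (G.length_pos e) (G.coord_mem_Icc e x) (G.coord_mem_Icc e y)

theorem integrable_circleResistance_coord (G : PMGraph V E) (e : E)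
    (μ : Measure (G.Point × G.Point)) [IsFiniteMeasure μ] :
    Integrable (fun z : G.Point × G.Point =>
      circleResistance (G.length e) (G.coord e z.1) (G.coord e z.2)) μ :=
  Integrable.of_bound (G.measurable_circleResistance_coord e).aestronglyMeasurable (G.length e)
    (Eventually.of_forall fun z => G.norm_circleResistance_coord_le e z.1 z.2)

variable [Unique V]

theorem genus_eq (G : PMGraph V E) : (G.genus : ℝ) = Fintype.card E + G.q default := by
  rw [genus, LengthGraph.bettiNumber, Fintype.card_unique (α := V), Fintype.sum_unique]
  push_cast
  ring

theorem genus_pos [Nonempty E] (G : PMGraph V E) : 0 < (G.genus : ℝ) := by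
  rw [genus_eq]
  have : 0 < (Fintype.card E : ℝ) := by exact_mod_cast Fintype.card_pos
  positivity

/-- Each loop contributes two directions, so the coefficient at the vertex is 2|E| - 2 + 2q = 2g -
2. -/
theorem canonicalDivisorMeasure_eq (G : PMGraph V E) :
    G.canonicalDivisorMeasure = ENNReal.ofReal (2 * G.genus - 2) •
      Measure.dirac (LengthGraph.Point.vertex default : G.Point) := by
  have h : G.canonicalDivisor default = 2 * G.genus - 2 := by
    rw [canonicalDivisor, LengthGraph.valence_vertex, genus, LengthGraph.bettiNumber,
      Fintype.card_unique (α := V), Fintype.sum_unique]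
    push_cast
    ring
  have h' : (2 * (G.genus : ℝ) - 2) = ((G.canonicalDivisor default : ℤ) : ℝ) := by
    rw [h]
    push_cast
    ring
  rw [canonicalDivisorMeasure, Fintype.sum_unique, h', ← Nat.cast_smul_eq_nsmul ENNReal]
  congr 1
  -- Effectivity is what makes the truncation by `toNat` harmless.
  have h0 : 0 ≤ G.canonicalDivisor default := G.effective default
  lift G.canonicalDivisor default to ℕ using h0 with n
  simp

theorem admissibleMeasure_eq (G : PMGraph V E) :
    G.admissibleMeasure = ENNReal.ofReal (1 / G.genus) •
      (ENNReal.ofReal (G.q default) • Measure.dirac (LengthGraph.Point.vertex default : G.Point) +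
        ∑ e, ENNReal.ofReal (G.length e)⁻¹ • G.edgeMeasure e) := by
  rw [admissibleMeasure, Fintype.sum_unique, ← Nat.cast_smul_eq_nsmul ENNReal,
    ENNReal.ofReal_natCast]
  congr 2
  refine Finset.sum_congr rfl fun e _ => ?_
  rw [LengthGraph.deletedResistance_of_subsingleton, add_zero,
    ENNReal.ofReal_inv_of_pos (G.length_pos e)]

theorem isFiniteMeasure_admissibleMeasure (G : PMGraph V E) :
    IsFiniteMeasure G.admissibleMeasure := by
  have := G.isFiniteMeasure_edgeMeasure
  have h : ∀ e, IsFiniteMeasure (ENNReal.ofReal (G.length e)⁻¹ • G.edgeMeasure e) :=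
    fun e => Measure.smul_finite _ ENNReal.ofReal_ne_top
  have h' := Measure.smul_finite (Measure.dirac (LengthGraph.Point.vertex default : G.Point))
    (ENNReal.ofReal_ne_top (r := (G.q default : ℝ)))
  rw [admissibleMeasure_eq]
  refine Measure.smul_finite _ ENNReal.ofReal_ne_top

theorem integral_admissibleMeasure [Nonempty E] (G : PMGraph V E) {F : G.Point → ℝ}
    (hF : Measurable F) {C : ℝ} (hC : ∀ x, ‖F x‖ ≤ C) :
    ∫ x, F x ∂G.admissibleMeasure = (G.q default * F (LengthGraph.Point.vertex default) +
      ∑ e, (G.length e)⁻¹ * ∫ t in (0 : ℝ)..G.length e, F (G.edgePath e t)) / G.genus := by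
  have := G.isFiniteMeasure_edgeMeasure
  have hint : ∀ (ν : Measure G.Point) [IsFiniteMeasure ν], Integrable F ν := fun ν _ =>
    Integrable.of_bound hF.aestronglyMeasurable C (Eventually.of_forall hC)
  have hint' : ∀ e, Integrable F (ENNReal.ofReal (G.length e)⁻¹ • G.edgeMeasure e) :=
    fun e => (hint _).smul_measure ENNReal.ofReal_ne_top
  rw [admissibleMeasure_eq, integral_smul_measure,
    integral_add_measure ((hint _).smul_measure ENNReal.ofReal_ne_top)
      (integrable_finsetSum_measure.2 fun e _ => hint' e),
    integral_finsetSum_measure fun e _ => hint' e, integral_smul_measure,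
    integral_dirac' _ _ hF.stronglyMeasurable, ENNReal.toReal_ofReal (Nat.cast_nonneg _),
    ENNReal.toReal_ofReal (one_div_nonneg.2 G.genus_pos.le), smul_eq_mul, smul_eq_mul,
    one_div_mul_eq_div]
  congr 2
  refine Finset.sum_congr rfl fun e _ => ?_
  rw [integral_smul_measure, G.integral_edgeMeasure e hF, smul_eq_mul,
    ENNReal.toReal_ofReal (inv_nonneg.2 (G.length_pos e).le)]

/-- Before normalization the vertex carries mass q and each loop mass 1, and q + |E| = g. -/
theorem admissibleMeasure_real_univ [Nonempty E] (G : PMGraph V E) :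
    G.admissibleMeasure.real univ = 1 := by
  have h := G.integral_admissibleMeasure (F := fun _ => 1) measurable_const (C := 1) (by simp)
  have h1 : ∀ e, (G.length e)⁻¹ * G.length e = 1 := fun e => inv_mul_cancel₀ (G.length_pos e).ne'
  have h2 : (G.q default : ℝ) + Fintype.card E = G.genus := by rw [genus_eq, add_comm]
  simpa [h1, h2, G.genus_pos.ne'] using h

/-! ### The integrals defining ε and Z -/

theorem integral_circleResistance_coord [Nonempty E] (G : PMGraph V E) (e : E) (x : G.Point) :
    ∫ y, circleResistance (G.length e) (G.coord e x) (G.coord e y) ∂G.admissibleMeasure =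
      ((G.genus - 1) * circleResistance (G.length e) (G.coord e x) 0 + G.length e / 6) /
        G.genus := by
  classical
  have hL := G.length_pos e
  rw [G.integral_admissibleMeasure
    (F := fun y => circleResistance (G.length e) (G.coord e x) (G.coord e y))
    ((G.measurable_circleResistance_coord e).comp measurable_prodMk_left)
    (G.norm_circleResistance_coord_le e x), ← Finset.sum_erase_add _ _ (Finset.mem_univ e)]
  have hself : ∫ t in (0 : ℝ)..G.length e,
      circleResistance (G.length e) (G.coord e x) (G.coord e (G.edgePath e t)) =
        G.length e ^ 2 / 6 := by
    rw [← intervalIntegral_circleResistance hL (G.coord_mem_Icc e x)]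
    refine intervalIntegral.integral_congr fun t ht => ?_
    rw [uIcc_of_le hL.le] at ht
    rcases ht.2.eq_or_lt with h | h
    · rw [h, G.coord_edgePath_length, circleResistance_comm _ _ (G.length e),
        circleResistance_length_left hL (G.coord_mem_Icc e x), circleResistance_comm]
    · rw [G.coord_edgePath_self ⟨ht.1, h⟩]
  -- Every other loop is collapsed to coordinate 0 and has mass 1. Together with the q at the vertex
  -- this gives the weight |E| - 1 + q = g - 1.
  have hother : ∀ e' ∈ Finset.univ.erase e, (G.length e')⁻¹ * ∫ t in (0 : ℝ)..G.length e',
      circleResistance (G.length e) (G.coord e x) (G.coord e (G.edgePath e' t)) =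
        circleResistance (G.length e) (G.coord e x) 0 := by
    intro e' he'
    simp only [G.coord_edgePath_of_ne (Finset.ne_of_mem_erase he')]
    rw [intervalIntegral.integral_const, sub_zero, smul_eq_mul,
      inv_mul_cancel_left₀ (G.length_pos e').ne']
  rw [hself, Finset.sum_congr rfl hother, Finset.sum_const,
    Finset.card_erase_of_mem (Finset.mem_univ e), Finset.card_univ, nsmul_eq_mul,
    Nat.cast_pred Fintype.card_pos, G.coord_vertex, genus_eq]
  congr 1
  field_simp
  ring

theorem integral_circleResistance_coord_zero [Nonempty E] (G : PMGraph V E) (e : E) :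
    ∫ x, circleResistance (G.length e) (G.coord e x) 0 ∂G.admissibleMeasure =
      G.length e / 6 / G.genus := by
  have h := G.integral_circleResistance_coord e (LengthGraph.Point.vertex default)
  simp only [G.coord_vertex, circleResistance_self, mul_zero, zero_add] at h
  simpa only [circleResistance_comm _ (G.coord e _) 0] using h

theorem integral_r (G : PMGraph V E) (μ : Measure (G.Point × G.Point)) [IsFiniteMeasure μ] :
    ∫ z, G.r z.1 z.2 ∂μ =
      ∑ e, ∫ z, circleResistance (G.length e) (G.coord e z.1) (G.coord e z.2) ∂μ := by
  simp only [r, LengthGraph.resistance_toReal_of_subsingleton]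
  exact integral_finsetSum _ fun e _ => G.integrable_circleResistance_coord e μ

theorem epsilonInv_eq [Nonempty E] (G : PMGraph V E) :
    G.epsilonInv = ((G.genus : ℝ) - 1) / (3 * G.genus) * G.totalLength := by
  have := G.isFiniteMeasure_admissibleMeasure
  -- The genus is a positive integer, hence at least 1; so `ENNReal.ofReal` does not truncate the
  -- mass of δ_K.
  have hK : 0 ≤ 2 * (G.genus : ℝ) - 2 := by
    have h : (1 : ℤ) ≤ G.genus := by exact_mod_cast G.genus_pos
    have h : (1 : ℝ) ≤ G.genus := by exact_mod_cast h
    linarith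
  have hfin := Measure.smul_finite (Measure.dirac (LengthGraph.Point.vertex default : G.Point))
    (ENNReal.ofReal_ne_top (r := 2 * (G.genus : ℝ) - 2))
  rw [epsilonInv, canonicalDivisorMeasure_eq, integral_r, LengthGraph.totalLength, Finset.mul_sum]
  refine Finset.sum_congr rfl fun e _ => ?_
  rw [integral_prod _ (G.integrable_circleResistance_coord e _), integral_smul_measure,
    ENNReal.toReal_ofReal hK]
  simp only [integral_circleResistance_coord]
  -- At the vertex the resistance term vanishes, which leaves (2g - 2) L_e/(6g).
  rw [integral_dirac' _ _ (Measurable.stronglyMeasurable ?_), G.coord_vertex,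
    circleResistance_self, smul_eq_mul]
  · have := G.genus_pos
    field_simp
    ring
  · have h : Measurable fun x => circleResistance (G.length e) (G.coord e x) 0 :=
      (G.measurable_circleResistance_coord e).comp
        (measurable_id.prodMk (measurable_const (a := LengthGraph.Point.vertex default)))
    exact ((h.const_mul _).add_const _).div_const _

theorem zInv_eq [Nonempty E] (G : PMGraph V E) :
    G.zInv = (2 * (G.genus : ℝ) - 1) / (12 * (G.genus : ℝ) ^ 2) * G.totalLength := by
  have := G.isFiniteMeasure_admissibleMeasure
  have hg := G.genus_pos
  rw [zInv, integral_r, LengthGraph.totalLength, Finset.mul_sum, Finset.mul_sum]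
  refine Finset.sum_congr rfl fun e _ => ?_
  have h : Integrable (fun x => circleResistance (G.length e) (G.coord e x) 0)
      G.admissibleMeasure :=
    Integrable.of_bound ((G.measurable_circleResistance_coord e).comp
        (measurable_id.prodMk (measurable_const (a := LengthGraph.Point.vertex default)))
      ).aestronglyMeasurable (G.length e)
      (Eventually.of_forall fun x =>
        G.norm_circleResistance_coord_le e x (LengthGraph.Point.vertex default))
  rw [integral_prod _ (G.integrable_circleResistance_coord e _)]
  -- The inner integral leaves a multiple of r_e(x, 0) plus a constant; the former has mean
  -- L_e/(6g), and the latter is unchanged because μ_ad has mass 1.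
  simp only [integral_circleResistance_coord]
  rw [integral_div, integral_add (h.const_mul _) (integrable_const _), integral_const_mul,
    integral_circleResistance_coord_zero, integral_const, admissibleMeasure_real_univ, one_smul]
  field_simp
  ring

end PMGraph

/-! ### The four formulas -/

theorem mainTheorem3 {V E : Type*} [Fintype V] [Fintype E] (G : PMGraph V E)
    (hV : Fintype.card V = 1) (hE : 1 ≤ Fintype.card E) :
    G.phiInv = ((G.genus : ℝ) - 1) / (6 * (G.genus : ℝ)) * G.totalLength ∧
    G.zInv = (2 * (G.genus : ℝ) - 1) / (12 * (G.genus : ℝ) ^ 2) * G.totalLength ∧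
    G.lambdaInv = (G.genus : ℝ) / (8 * (G.genus : ℝ) + 4) * G.totalLength ∧
    G.epsilonInv = ((G.genus : ℝ) - 1) / (3 * (G.genus : ℝ)) * G.totalLength := by
  obtain ⟨_⟩ := Fintype.card_eq_one_iff_nonempty_unique.1 hV
  have : Nonempty E := Fintype.card_pos_iff.1 hE
  have hg := G.genus_pos
  have hφ : G.phiInv = ((G.genus : ℝ) - 1) / (6 * (G.genus : ℝ)) * G.totalLength := by
    rw [PMGraph.phiInv, G.zInv_eq, G.epsilonInv_eq]
    field_simp
    ring
  refine ⟨hφ, G.zInv_eq, ?_, G.epsilonInv_eq⟩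
  rw [PMGraph.lambdaInv, hφ, G.epsilonInv_eq]
  field_simp
  ring
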